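/- Let $m,s$ be integers with $0\le s\le m$. For $\tau\in\mathbb{C}$ with $\operatorname{Im}\tau>0$ write $q^{r}=e^{2\pi i r\tau}$. For $z_1,z_2\in\mathbb{C}$ with $z_1\notin\mathbb{Z}+\mathbb{Z}\tau$ put $$\Phi_1^{[m;s]}(\tau,z_1,z_2)=\sum_{j\in\mathbb{Z}}\frac{e^{2\pi i(m+1)j(z_1+z_2)}\,e^{-2\pi i s z_1}\,q^{j^2(m+1)-js}}{1-e^{2\pi i z_1}q^{j}},$$ and for $z_1,z_2\notin\mathbb{Z}+\mathbb{Z}\tau$ and $t\in\mathbb{C}$ put $$\Phi^{[m;s]}(\tau,z_1,z_2,t)=e^{2\pi i(m+1)t}\left(\Phi_1^{[m;s]}(\tau,z_1,z_2)-\Phi_1^{[m;s]}(\tau,-z_2,-z_1)\right).$$ (This explicit function is the coordinate expression of the numerator of the supercharacter of the atypical integrable $\widehat{s\ell}_{2|1}$-module $L(\Lambda_{m;s})$; here it is taken as the definition of $\Phi^{[m;s]}$.) For $j\in\mathbb{Z}$ and $z,v\in\mathbb{C}$ let $$\Theta_{j,m+1}(\tau,z)=\sum_{n\in\mathbb{Z}}e^{2\pi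 i(m+1)z\left(n+\frac{j}{2(m+1)}\right)}\,q^{(m+1)\left(n+\frac{j}{2(m+1)}\right)^2},$$ $$R_{j;m+1}(\tau,v)=\sum_{\substack{n\in\mathbb{Z}\\ n\equiv -j \bmod 2(m+1)}}\left(\operatorname{sgn}\left(n+\tfrac12+j-2(m+1)\right)-E\left(\left(n+2(m+1)\tfrac{\operatorname{Im}v}{\operatorname{Im}\tau}\right)\sqrt{\tfrac{\operatorname{Im}\tau}{m+1}}\right)\right)e^{-\frac{\pi i n^2}{2(m+1)}\tau-2\pi i n v},$$ where $E(x)=2\int_0^x e^{-\pi u^2}\,du$. Let $$\Phi_{\mathrm{add}}^{[m;s]}(\tau,z_1,z_2,t)=\tfrac12 e^{2\pi i(m+1)t}\sum_{j=-s}^{-s+2m+1}R_{j;m+1}\left(\tau,\tfrac{z_1-z_2}{2}\right)\left(\Theta_{j,m+1}-\Theta_{-j,m+1}\right)(\tau,z_1+z_2),$$ and $\widetilde\Phi^{[m;s]}=\Phi^{[m;s]}+\Phi_{\mathrm{add}}^{[m;s]}$. For a function $F(\tau,z_1,z_2,t)$ put $$F|_S(\tau,z_1,z_2,t)=\tfrac1\tau\,F\left(-\tfrac1\tau,\tfrac{z_1}{\tau},\tfrac{z_2}{\tau},t-\tfrac{z_1z_2}{\tau}\right).$$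 **Theorem.** The series for $\Phi_1^{[m;s]}(\tau,z_1,z_2)$ (for $\operatorname{Im}\tau>0$, $z_1\notin\mathbb{Z}+\mathbb{Z}\tau$, $z_2\in\mathbb{C}$), $\Theta_{j,m+1}(\tau,z)$ and $R_{j;m+1}(\tau,v)$ (for $\operatorname{Im}\tau>0$, $z,v\in\mathbb{C}$, $j\in\mathbb{Z}$) converge absolutely, and for all $\tau,z_1,z_2,t\in\mathbb{C}$ with $\operatorname{Im}\tau>0$ and $z_1,z_2\notin\mathbb{Z}+\mathbb{Z}\tau$: 1. $\widetilde\Phi^{[m;s]}|_S=\widetilde\Phi^{[m;s]}$, i.e. $\widetilde\Phi^{[m;s]}\left(-\tfrac1\tau,\tfrac{z_1}{\tau},\tfrac{z_2}{\tau},t\right)=\tau\,e^{\frac{2\pi i(m+1)z_1z_2}{\tau}}\,\widetilde\Phi^{[m;s]}(\tau,z_1,z_2,t)$; 2. $\widetilde\Phi^{[m;s]}(\tau+1,z_1,z_2,t)=\widetilde\Phi^{[m;s]}(\tau,z_1,z_2,t)$; 3. $\widetilde\Phi^{[m;s]}(\tau,z_1+a,z_2+b,t)=\widetilde\Phi^{[m;s]}(\tau,z_1,z_2,t)$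 for all $a,b\in\mathbb{Z}$; 4. $\widetilde\Phi^{[m;s]}(\tau,z_1+a\tau,z_2+b\tau,t)=q^{-(m+1)ab}\,e^{-2\pi i(m+1)(bz_1+az_2)}\,\widetilde\Phi^{[m;s]}(\tau,z_1,z_2,t)$ for all $a,b\in\mathbb{Z}$. -/

import Mathlib

namespace MockTheta

/-- `e x = exp (2 π i x)`; in particular `q ^ r = e (r * τ)` for `q = exp (2 π i τ)`. -/
noncomputable def e (x : ℂ) : ℂ :=
  Complex.exp (2 * (Real.pi : ℂ) * Complex.I * x)

/-- The summand with index `j` of the series `Φ₁^{[m;s]}(τ, z₁, z₂)`. -/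
noncomputable def Phi1Term (m s : ℕ) (τ z₁ z₂ : ℂ) (j : ℤ) : ℂ :=
  e (((m : ℂ) + 1) * (j : ℂ) * (z₁ + z₂)) * e (-((s : ℂ) * z₁))
      * e (((j : ℂ) ^ 2 * ((m : ℂ) + 1) - (j : ℂ) * (s : ℂ)) * τ)
    / (1 - e z₁ * e ((j : ℂ) * τ))

/-- `Φ₁^{[m;s]}(τ, z₁, z₂)`. -/
noncomputable def Phi1 (m s : ℕ) (τ z₁ z₂ : ℂ) : ℂ :=
  ∑' j : ℤ, Phi1Term m s τ z₁ z₂ j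

/-- `Φ^{[m;s]}(τ, z₁, z₂, t)`, the numerator of the supercharacter, in coordinates. -/
noncomputable def Phi (m s : ℕ) (τ z₁ z₂ t : ℂ) : ℂ :=
  e (((m : ℂ) + 1) * t) * (Phi1 m s τ z₁ z₂ - Phi1 m s τ (-z₂) (-z₁))

/-- The summand with index `n` of the theta function `Θ_{j,M}(τ, z)` of degree `M`. -/
noncomputable def thetaTerm (j : ℤ) (M : ℕ) (τ z : ℂ) (n : ℤ) : ℂ :=
  e ((M : ℂ) * z * ((n : ℂ) + (j : ℂ) / (2 * (M : ℂ))))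
    * e ((M : ℂ) * ((n : ℂ) + (j : ℂ) / (2 * (M : ℂ))) ^ 2 * τ)

/-- The classical theta function `Θ_{j,M}(τ, z) = Θ_{j,M}(τ, z, 0)` of degree `M`. -/
noncomputable def Theta (j : ℤ) (M : ℕ) (τ z : ℂ) : ℂ :=
  ∑' n : ℤ, thetaTerm j M τ z n

/-- `E(x) = 2 ∫₀ˣ exp (-π u²) du`. -/
noncomputable def E (x : ℝ) : ℝ :=
  2 * ∫ u in (0 : ℝ)..x, Real.exp (-(Real.pi * u ^ 2))

/-- The summand with index `n` of the modified Zwegers function `R_{j;M}(τ, v)`. -/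
noncomputable def RTerm (j : ℤ) (M : ℕ) (τ v : ℂ) (n : ℤ) : ℂ :=
  ((Real.sign ((n : ℝ) + 1 / 2 + (j : ℝ) - 2 * (M : ℝ))
      - E (((n : ℝ) + 2 * (M : ℝ) * (v.im / τ.im)) * Real.sqrt (τ.im / (M : ℝ))) : ℝ) : ℂ)
    * Complex.exp (-((Real.pi : ℂ) * Complex.I * (n : ℂ) ^ 2 / (2 * (M : ℂ)) * τ)
        - 2 * (Real.pi : ℂ) * Complex.I * (n : ℂ) * v)

/-- The modified Zwegers function `R_{j;M}(τ, v)`: the sum over all integers `n` with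
`n ≡ -j` modulo `2M`. -/
noncomputable def R (j : ℤ) (M : ℕ) (τ v : ℂ) : ℂ :=
  ∑' n : {n : ℤ // n ≡ -j [ZMOD 2 * (M : ℤ)]}, RTerm j M τ v n.1

/-- The correction `Φ_add^{[m;s]}(τ, z₁, z₂, t)`. -/
noncomputable def PhiAdd (m s : ℕ) (τ z₁ z₂ t : ℂ) : ℂ :=
  (1 / 2) * e (((m : ℂ) + 1) * t)
    * ∑ j ∈ Finset.Icc (-(s : ℤ)) (-(s : ℤ) + 2 * (m : ℤ) + 1),
        R j (m + 1) τ ((z₁ - z₂) / 2)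
          * (Theta j (m + 1) τ (z₁ + z₂) - Theta (-j) (m + 1) τ (z₁ + z₂))

/-- The modified numerator `Φ̃^{[m;s]} = Φ^{[m;s]} + Φ_add^{[m;s]}`. -/
noncomputable def PhiTilde (m s : ℕ) (τ z₁ z₂ t : ℂ) : ℂ :=
  Phi m s τ z₁ z₂ t + PhiAdd m s τ z₁ z₂ t

/-- The weight one action of `S` on functions of `(τ, z₁, z₂, t)`. -/
noncomputable def slashS (F : ℂ → ℂ → ℂ → ℂ → ℂ) (τ z₁ z₂ t : ℂ) : ℂ :=
  (1 / τ) * F (-1 / τ) (z₁ / τ) (z₂ / τ) (t - z₁ * z₂ / τ)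

end MockTheta

/-!
# Modularity of the completed supercharacter numerator

Put `M = m + 1`, `y = Im τ`, `ζ = z₁ + a τ + b`. The lattice sum
`P(z₁, z₂) = Σ_{a, b} e(M a z₂) exp(-π M |ζ|² / y) e(-M ζ Im z₂ / y) / ζ`
converges absolutely, and a change of `τ` by a modular transformation or of `(z₁, z₂)` by a
lattice vector only permutes its terms, up to the automorphy factor of the index form
`M z₁ z₂` (`latticeSum_S`, `latticeSum_T`, `latticeSum_add_mul`). So it suffices to prove
(`Phi1_add_correction`)

`Φ₁(z₁, z₂) + ½ Σ_j R_j((z₁ - z₂)/2) Θ_j(z₁ + z₂) = -P(z₁, z₂) / (2πi)`,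

because `(z₁, z₂) ↦ (-z₂, -z₁)` fixes `z₁ - z₂` and exchanges `Θ_j` with `Θ_{-j}`, whence `Φ̃` is
the antisymmetrization of this expression under that map (`PhiTilde_eq_latticeSum`).

For fixed `a` the sum over `b` in `P` is a periodized Cauchy kernel damped by a Gaussian. Its
Fourier expansion (`tsum_gaussKernel_div`) consists of the Appell term `e(-sζ) / (1 - e ζ)` and of
a series with coefficients `sgn(n - s - ½) - E((n + β) r)`, `r² = y / M`, `β = 2 M Im v / y`,
`v = (z₁ - z₂)/2`. Here no contour integral is needed: as functions of the real variable `β` the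
two sides have equal derivatives by Poisson summation, so that their difference is constant, while
`β ↦ β + 1` multiplies it by `e ζ ≠ 1`. Summing over `a` gives `Φ₁`, and a double series which
(after interchanging the summations and sorting `n` by residue classes modulo `2M`) is
`½ Σ_j R_j Θ_j`. The Fubini steps rest on the bound `abs_zwegersCoeff_le` for the coefficients,
and they also yield the absolute convergence of `Φ₁`.

The lattice sum does not involve `s`, so neither does `Φ̃`.
-/

namespace MockTheta

open Filter Topology ComplexConjugate

/-! ### The exponential `e` -/

lemma norm_e (x : ℂ) : ‖e x‖ = Real.exp (-(2 * Real.pi * x.im)) := by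
  rw [e, Complex.norm_exp]
  congr 1
  simp

lemma e_add (x y : ℂ) : e (x + y) = e x * e y := by
  rw [e, e, e, ← Complex.exp_add]
  congr 1
  ring

lemma e_int (n : ℤ) : e n = 1 := by
  rw [e, Complex.exp_eq_one_iff]
  exact ⟨n, by ring⟩

lemma e_ne_zero (x : ℂ) : e x ≠ 0 := Complex.exp_ne_zero _

lemma e_neg (x : ℂ) : e (-x) = (e x)⁻¹ := by
  rw [e, e, ← Complex.exp_neg]
  congr 1
  ring

lemma e_eq_one_iff (x : ℂ) : e x = 1 ↔ ∃ n : ℤ, x = n := by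
  refine ⟨fun h => ?_, fun ⟨n, hn⟩ => hn ▸ e_int n⟩
  obtain ⟨n, hn⟩ := Complex.exp_eq_one_iff.1 h
  refine ⟨n, ?_⟩
  have : (2 * (Real.pi : ℂ) * Complex.I) ≠ 0 := Complex.two_pi_I_ne_zero
  exact mul_left_cancel₀ this (hn.trans (by ring))

/-! ### Gaussian sums -/

/-- The discrete Gaussian `exp (-p n² + k n)` is summable over `ℤ`. -/
lemma summable_exp_quadratic {p : ℝ} (hp : 0 < p) (k : ℝ) :
    Summable fun n : ℤ => Real.exp (-p * (n : ℝ) ^ 2 + k * n) := by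
  have hτ : 0 < (Complex.I * ((p / Real.pi : ℝ) : ℂ)).im := by
    simp only [Complex.I_mul_im, Complex.ofReal_re]
    exact div_pos hp Real.pi_pos
  have h := ((summable_jacobiTheta₂_term_iff
    (-(Complex.I * ((k / (2 * Real.pi) : ℝ) : ℂ))) _).2 hτ).norm
  refine h.congr fun n => ?_
  rw [norm_jacobiTheta₂_term]
  have : Real.pi ≠ 0 := Real.pi_ne_zero
  congr 1
  simp only [Complex.I_mul_im, Complex.ofReal_re, Complex.neg_im]
  field_simp
  ring

/-- A family on `ℤ × ℤ` bounded by the exponential of a quadratic polynomial with negative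
definite leading part is summable. -/
lemma summable_of_norm_le_exp_quadratic {f : ℤ × ℤ → ℂ} {p K : ℝ} (hp : 0 < p) (k l : ℝ)
    (hf : ∀ x : ℤ × ℤ, ‖f x‖ ≤ K * Real.exp (-p * ((x.1 : ℝ) ^ 2 + (x.2 : ℝ) ^ 2)
      + k * x.1 + l * x.2)) :
    Summable f := by
  have h := ((summable_exp_quadratic hp k).mul_of_nonneg (summable_exp_quadratic hp l)
    (fun _ => (Real.exp_pos _).le) (fun _ => (Real.exp_pos _).le)).mul_left K
  refine Summable.of_norm_bounded h fun x => (hf x).trans (le_of_eq ?_)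
  rw [← Real.exp_add]
  congr 2
  ring

/-! ### The error function -/

lemma continuous_gaussian : Continuous fun u : ℝ => Real.exp (-(Real.pi * u ^ 2)) := by
  fun_prop

lemma hasDerivAt_E (x : ℝ) : HasDerivAt E (2 * Real.exp (-(Real.pi * x ^ 2))) x := by
  have h := intervalIntegral.integral_hasDerivAt_right
    (continuous_gaussian.intervalIntegrable 0 x)
    (continuous_gaussian.stronglyMeasurableAtFilter _ _) continuous_gaussian.continuousAt
  exact h.const_mul 2

lemma E_neg (x : ℝ) : E (-x) = -E x := by
  unfold E
  have h := intervalIntegral.integral_comp_neg (a := 0) (b := -x)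
    (fun u : ℝ => Real.exp (-(Real.pi * u ^ 2)))
  simp only [neg_sq, neg_zero, neg_neg] at h
  rw [h, intervalIntegral.integral_symm]
  ring

lemma E_zero : E 0 = 0 := by simp [E]

lemma E_mono : Monotone E :=
  monotone_of_hasDerivAt_nonneg hasDerivAt_E fun x => by positivity

lemma tendsto_E_atTop : Tendsto E atTop (𝓝 1) := by
  have hint : MeasureTheory.Integrable fun u : ℝ => Real.exp (-(Real.pi * u ^ 2)) := by
    simpa only [neg_mul] using integrable_exp_neg_mul_sq Real.pi_pos
  have h := (MeasureTheory.intervalIntegral_tendsto_integral_Ioi 0 hint.integrableOn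
    tendsto_id).const_mul 2
  have h2 := integral_gaussian_Ioi Real.pi
  simp only [neg_mul, div_self Real.pi_ne_zero, Real.sqrt_one] at h2
  rw [h2] at h
  rw [show 2 * (1 / 2 : ℝ) = 1 by norm_num] at h
  exact h

lemma E_le_one (x : ℝ) : E x ≤ 1 := E_mono.ge_of_tendsto tendsto_E_atTop x

lemma abs_E_le_one (x : ℝ) : |E x| ≤ 1 := by
  rw [abs_le]
  have := E_le_one (-x)
  rw [E_neg] at this
  exact ⟨by linarith, E_le_one x⟩

/-- Gaussian tail estimate, from `E (x + T) ≤ E x + exp (-π x²) E T` as `T → ∞`. -/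
lemma one_sub_E_le {x : ℝ} (hx : 0 ≤ x) : 1 - E x ≤ Real.exp (-(Real.pi * x ^ 2)) := by
  have key : ∀ T : ℝ, 0 ≤ T → E (T + x) ≤ E x + Real.exp (-(Real.pi * x ^ 2)) * E T := by
    intro T hT
    let g : ℝ → ℝ := fun T => E x + Real.exp (-(Real.pi * x ^ 2)) * E T - E (T + x)
    have hg : ∀ T, HasDerivAt g (Real.exp (-(Real.pi * x ^ 2))
        * (2 * Real.exp (-(Real.pi * T ^ 2))) - 2 * Real.exp (-(Real.pi * (T + x) ^ 2))) T :=
      fun T => (((hasDerivAt_E T).const_mul _).const_add _).sub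
        ((hasDerivAt_E (T + x)).comp_add_const T x)
    have hmono : MonotoneOn g (Set.Ici 0) := by
      refine monotoneOn_of_hasDerivWithinAt_nonneg (convex_Ici 0)
        (fun y _ => (hg y).continuousAt.continuousWithinAt)
        (fun y _ => (hg y).hasDerivWithinAt) fun y hy => ?_
      rw [interior_Ici, Set.mem_Ioi] at hy
      have : Real.exp (-(Real.pi * (y + x) ^ 2))
          ≤ Real.exp (-(Real.pi * x ^ 2)) * Real.exp (-(Real.pi * y ^ 2)) := by
        rw [← Real.exp_add, Real.exp_le_exp]
        nlinarith [mul_nonneg Real.pi_pos.le (mul_nonneg hx hy.le)]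
      linarith
    have := hmono Set.self_mem_Ici (Set.mem_Ici.2 hT) hT
    simp only [g, E_zero, zero_add, mul_zero, add_zero, sub_self] at this
    linarith
  have h1 : Tendsto (fun T => E (T + x)) atTop (𝓝 1) :=
    tendsto_E_atTop.comp (tendsto_atTop_add_const_right _ _ tendsto_id)
  have h2 : Tendsto (fun T => E x + Real.exp (-(Real.pi * x ^ 2)) * E T) atTop
      (𝓝 (E x + Real.exp (-(Real.pi * x ^ 2)) * 1)) :=
    (tendsto_E_atTop.const_mul _).const_add _
  have := le_of_tendsto_of_tendsto h1 h2 ((eventually_ge_atTop 0).mono key)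
  linarith

lemma abs_sign_sub_E_le (x : ℝ) : |Real.sign x - E x| ≤ Real.exp (-(Real.pi * x ^ 2)) := by
  rcases lt_trichotomy x 0 with h | h | h
  · have h1 := one_sub_E_le (neg_nonneg.2 h.le)
    have h2 := E_le_one (-x)
    rw [E_neg] at h1 h2
    rw [neg_sq] at h1
    rw [Real.sign_of_neg h, abs_of_nonpos (by linarith)]
    linarith
  · subst h
    simp [E_zero]
  · have h1 := one_sub_E_le h.le
    have h2 := E_le_one x
    rw [Real.sign_of_pos h, abs_of_nonneg (by linarith)]
    linarith

lemma abs_sign_le_one (x : ℝ) : |Real.sign x| ≤ 1 := by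
  rcases Real.sign_apply_eq x with h | h | h <;> simp [h]

/-- The coefficient `sgn (n + c) - E ((n + β) r)` of Zwegers' nonholomorphic series. -/
noncomputable def zwegersCoeff (r c β : ℝ) (n : ℤ) : ℝ :=
  Real.sign ((n : ℝ) + c) - E (((n : ℝ) + β) * r)

/-- If `n + c` and `n + β` have the same sign, this is the tail estimate for `E`; otherwise
`|n + β| ≤ |c - β|` and the trivial bound `2` suffices. -/
lemma abs_zwegersCoeff_le {r : ℝ} (hr : 0 < r) (c β : ℝ) (n : ℤ) :
    |zwegersCoeff r c β n| ≤ 2 * Real.exp (Real.pi * r ^ 2 * (c - β) ^ 2)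
      * Real.exp (-(Real.pi * r ^ 2 * ((n : ℝ) + β) ^ 2)) := by
  have hpi := Real.pi_pos
  by_cases h : Real.sign ((n : ℝ) + c) = Real.sign (((n : ℝ) + β) * r)
  · rw [zwegersCoeff, h]
    refine (abs_sign_sub_E_le _).trans ?_
    rw [show Real.pi * (((n : ℝ) + β) * r) ^ 2 = Real.pi * r ^ 2 * ((n : ℝ) + β) ^ 2 by ring]
    refine le_mul_of_one_le_left (Real.exp_pos _).le ?_
    have : 1 ≤ Real.exp (Real.pi * r ^ 2 * (c - β) ^ 2) := Real.one_le_exp (by positivity)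
    linarith
  · have hle : ((n : ℝ) + β) ^ 2 ≤ (c - β) ^ 2 := by
      have hmul : ((n : ℝ) + c) * ((n : ℝ) + β) ≤ 0 := by
        by_contra! hlt
        apply h
        rcases mul_pos_iff.1 hlt with ⟨h1, h2⟩ | ⟨h1, h2⟩
        · rw [Real.sign_of_pos h1, Real.sign_of_pos (mul_pos h2 hr)]
        · rw [Real.sign_of_neg h1, Real.sign_of_neg (mul_neg_of_neg_of_pos h2 hr)]
      nlinarith [sq_nonneg ((n : ℝ) + c)]
    have h2 : |zwegersCoeff r c β n| ≤ 2 := by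
      have := abs_sub (Real.sign ((n : ℝ) + c)) (E (((n : ℝ) + β) * r))
      have := abs_sign_le_one ((n : ℝ) + c)
      have := abs_E_le_one (((n : ℝ) + β) * r)
      unfold zwegersCoeff
      linarith
    rw [mul_assoc, ← Real.exp_add]
    have : 1 ≤ Real.exp (Real.pi * r ^ 2 * (c - β) ^ 2
        + -(Real.pi * r ^ 2 * ((n : ℝ) + β) ^ 2)) := by
      apply Real.one_le_exp
      have := mul_le_mul_of_nonneg_left hle (by positivity : 0 ≤ Real.pi * r ^ 2)
      linarith
    linarith

/-! ### The one-variable identity -/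

lemma eventually_one_le_norm {ι : Type*} {D : ι → ℂ} {p : ℝ} (hp : 0 < p)
    (h : Summable fun x => Real.exp (-p * ‖D x‖ ^ 2)) : ∀ᶠ x in cofinite, 1 ≤ ‖D x‖ := by
  have h2 := h.tendsto_cofinite_zero.eventually_lt_const (Real.exp_pos (-p))
  filter_upwards [h2] with x hx
  rw [Real.exp_lt_exp] at hx
  have : 1 < ‖D x‖ ^ 2 := by nlinarith
  nlinarith [norm_nonneg (D x)]

/-- The numerator of the Cauchy kernel damped by a Gaussian. -/
noncomputable def gaussKernel (r β : ℝ) (w : ℂ) : ℂ :=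
  Complex.exp (-(Real.pi * w ^ 2 / r ^ 2) + 2 * Real.pi * Complex.I * β * w)

lemma norm_gaussKernel (r β : ℝ) (w : ℂ) :
    ‖gaussKernel r β w‖ = Real.exp (-(Real.pi * (w.re ^ 2 - w.im ^ 2) / r ^ 2)
      - 2 * Real.pi * β * w.im) := by
  rw [gaussKernel, Complex.norm_exp]
  congr 1
  have h1 : ((Real.pi : ℂ) * w ^ 2 / r ^ 2).re = Real.pi * (w.re ^ 2 - w.im ^ 2) / r ^ 2 := by
    rw [show (Real.pi : ℂ) * w ^ 2 / r ^ 2 = ((Real.pi / r ^ 2 : ℝ) : ℂ) * (w * w) by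
      push_cast; ring, Complex.re_ofReal_mul, Complex.mul_re]
    ring
  have h2 : (2 * (Real.pi : ℂ) * Complex.I * β * w).re = -(2 * Real.pi * β * w.im) := by
    rw [show 2 * (Real.pi : ℂ) * Complex.I * β * w
      = ((2 * Real.pi * β : ℝ) : ℂ) * (Complex.I * w) by push_cast; ring,
      Complex.re_ofReal_mul, Complex.I_mul_re]
    ring
  rw [Complex.add_re, Complex.neg_re, h1, h2]
  ring

lemma norm_gaussKernel_add_int_le {r B β : ℝ} (hβ : |β| ≤ B) (ζ : ℂ) (b : ℤ) :
    ‖gaussKernel r β (ζ + b)‖ ≤ Real.exp (Real.pi * (ζ.im ^ 2 - ζ.re ^ 2) / r ^ 2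
      + 2 * Real.pi * B * |ζ.im|) * Real.exp (-(Real.pi / r ^ 2) * (b : ℝ) ^ 2
        + (-(2 * Real.pi / r ^ 2 * ζ.re)) * b) := by
  rw [norm_gaussKernel, ← Real.exp_add, Real.exp_le_exp]
  have : -(β * ζ.im) ≤ B * |ζ.im| := by
    refine (neg_le_abs _).trans ?_
    rw [abs_mul]
    exact mul_le_mul_of_nonneg_right hβ (abs_nonneg _)
  have := mul_le_mul_of_nonneg_left this Real.two_pi_pos.le
  simp only [Complex.add_re, Complex.add_im, Complex.intCast_re, Complex.intCast_im, add_zero]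
  have h3 : -(Real.pi * ((ζ.re + b) ^ 2 - ζ.im ^ 2) / r ^ 2) =
      Real.pi * (ζ.im ^ 2 - ζ.re ^ 2) / r ^ 2 + (-(Real.pi / r ^ 2) * (b : ℝ) ^ 2
        + (-(2 * Real.pi / r ^ 2 * ζ.re)) * b) := by
    ring
  rw [h3]
  linarith

lemma summable_gaussKernel_bound {r : ℝ} (hr : 0 < r) (K k : ℝ) :
    Summable fun b : ℤ => K * Real.exp (-(Real.pi / r ^ 2) * (b : ℝ) ^ 2 + k * b) :=
  (summable_exp_quadratic (by have := Real.pi_pos; positivity) k).mul_left K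

lemma summable_gaussKernel_div {r : ℝ} (hr : 0 < r) (β : ℝ) (ζ : ℂ) :
    Summable fun b : ℤ => gaussKernel r β (ζ + b) / (ζ + b) := by
  have hD : Summable fun b : ℤ => Real.exp (-1 * ‖ζ + (b : ℂ)‖ ^ 2) := by
    have h := (summable_exp_quadratic one_pos (-(2 * ζ.re))).mul_left
      (Real.exp (-(ζ.re ^ 2 + ζ.im ^ 2)))
    refine h.congr fun b => ?_
    rw [← Real.exp_add, ← Complex.normSq_eq_norm_sq, Complex.normSq_apply]
    congr 1
    simp only [Complex.add_re, Complex.add_im, Complex.intCast_re, Complex.intCast_im, add_zero]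
    ring
  refine Summable.of_norm_bounded_eventually (summable_gaussKernel_bound hr
    (Real.exp (Real.pi * (ζ.im ^ 2 - ζ.re ^ 2) / r ^ 2 + 2 * Real.pi * |β| * |ζ.im|))
    (-(2 * Real.pi / r ^ 2 * ζ.re))) ?_
  filter_upwards [eventually_one_le_norm one_pos hD] with b hb
  rw [norm_div]
  exact (div_le_self (norm_nonneg _) hb).trans (norm_gaussKernel_add_int_le le_rfl ζ b)

lemma hasDerivAt_tsum_gaussKernel_div {r : ℝ} (hr : 0 < r) (β : ℝ) {ζ : ℂ}
    (hζ : ∀ b : ℤ, ζ + b ≠ 0) :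
    HasDerivAt (fun β : ℝ => ∑' b : ℤ, gaussKernel r β (ζ + b) / (ζ + b))
      (∑' b : ℤ, 2 * Real.pi * Complex.I * gaussKernel r β (ζ + b)) β := by
  have hmem : β ∈ Metric.ball (0 : ℝ) (|β| + 1) := by
    rw [mem_ball_zero_iff, Real.norm_eq_abs]
    linarith
  have hu := (summable_gaussKernel_bound hr
    (Real.exp (Real.pi * (ζ.im ^ 2 - ζ.re ^ 2) / r ^ 2 + 2 * Real.pi * (|β| + 1) * |ζ.im|))
    (-(2 * Real.pi / r ^ 2 * ζ.re))).mul_left (2 * Real.pi)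
  refine hasDerivAt_tsum_of_isPreconnected
    (g := fun (b : ℤ) (x : ℝ) => gaussKernel r x (ζ + b) / (ζ + b))
    (g' := fun (b : ℤ) (x : ℝ) => 2 * Real.pi * Complex.I * gaussKernel r x (ζ + b))
    hu Metric.isOpen_ball (convex_ball (0 : ℝ) (|β| + 1)).isPreconnected
    (fun b x _ => ?_) (fun b x hx => ?_) hmem (summable_gaussKernel_div hr β ζ) hmem
  · have h0 := hζ b
    have h1 : HasDerivAt (fun x : ℝ => -(Real.pi * (ζ + b) ^ 2 / r ^ 2)
        + 2 * Real.pi * Complex.I * (x : ℂ) * (ζ + b))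
        (2 * Real.pi * Complex.I * 1 * (ζ + b)) x :=
      ((((hasDerivAt_id x).ofReal_comp).const_mul _).mul_const _).const_add _
    refine (h1.cexp.div_const (ζ + b)).congr_deriv ?_
    rw [gaussKernel]
    field_simp
  · rw [mem_ball_zero_iff, Real.norm_eq_abs] at hx
    rw [norm_mul]
    have h2 : ‖2 * (Real.pi : ℂ) * Complex.I‖ = 2 * Real.pi := by
      simp [abs_of_pos Real.pi_pos]
    rw [h2]
    exact mul_le_mul_of_nonneg_left (norm_gaussKernel_add_int_le hx.le ζ b) Real.two_pi_pos.le

lemma norm_e_neg_mul (n : ℤ) (ζ : ℂ) : ‖e (-(n * ζ))‖ = Real.exp (2 * Real.pi * ζ.im * n) := by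
  rw [norm_e]
  congr 1
  simp
  ring

lemma exp_neg_sq_add_le {r B β : ℝ} (hβ : |β| ≤ B) (n : ℤ) :
    Real.exp (-(Real.pi * r ^ 2 * ((n : ℝ) + β) ^ 2)) ≤ Real.exp (Real.pi * r ^ 2 * B ^ 2)
      * Real.exp (-(Real.pi * r ^ 2 / 2) * (n : ℝ) ^ 2) := by
  rw [← Real.exp_add, Real.exp_le_exp]
  have h1 : (n : ℝ) ^ 2 / 2 - B ^ 2 ≤ ((n : ℝ) + β) ^ 2 := by
    have := sq_le_sq' (neg_le_of_abs_le hβ) (le_of_abs_le hβ)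
    nlinarith [sq_nonneg ((n : ℝ) + 2 * β)]
  have := mul_le_mul_of_nonneg_left h1 (by have := Real.pi_pos; positivity :
    0 ≤ Real.pi * r ^ 2)
  linarith

lemma summable_zwegersCoeff_mul_e {r : ℝ} (hr : 0 < r) (c β : ℝ) (ζ : ℂ) :
    Summable fun n : ℤ => (zwegersCoeff r c β n : ℂ) * e (-(n * ζ)) := by
  refine Summable.of_norm_bounded ((summable_exp_quadratic
    (p := Real.pi * r ^ 2 / 2) (by have := Real.pi_pos; positivity)
    (2 * Real.pi * ζ.im)).mul_left (2 * Real.exp (Real.pi * r ^ 2 * (c - β) ^ 2)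
      * Real.exp (Real.pi * r ^ 2 * |β| ^ 2))) fun n => ?_
  rw [norm_mul, norm_e_neg_mul, Complex.norm_real, Real.norm_eq_abs, Real.exp_add, ← mul_assoc]
  refine mul_le_mul_of_nonneg_right ((abs_zwegersCoeff_le hr c β n).trans ?_)
    (Real.exp_pos _).le
  rw [mul_assoc (2 * Real.exp _)]
  exact mul_le_mul_of_nonneg_left (exp_neg_sq_add_le le_rfl n) (by positivity)

lemma hasDerivAt_tsum_zwegersCoeff {r : ℝ} (hr : 0 < r) (c β : ℝ) (ζ : ℂ) :
    HasDerivAt (fun β : ℝ => ∑' n : ℤ, (zwegersCoeff r c β n : ℂ) * e (-(n * ζ)))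
      (∑' n : ℤ, ((-(2 * Real.exp (-(Real.pi * (((n : ℝ) + β) * r) ^ 2)) * r) : ℝ) : ℂ)
        * e (-(n * ζ))) β := by
  have hmem : β ∈ Metric.ball (0 : ℝ) (|β| + 1) := by
    rw [mem_ball_zero_iff, Real.norm_eq_abs]
    linarith
  have hu := (summable_exp_quadratic
    (p := Real.pi * r ^ 2 / 2) (by have := Real.pi_pos; positivity)
    (2 * Real.pi * ζ.im)).mul_left (2 * r * Real.exp (Real.pi * r ^ 2 * (|β| + 1) ^ 2))
  refine hasDerivAt_tsum_of_isPreconnected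
    (g := fun (n : ℤ) (x : ℝ) => (zwegersCoeff r c x n : ℂ) * e (-(n * ζ)))
    (g' := fun (n : ℤ) (x : ℝ) =>
      ((-(2 * Real.exp (-(Real.pi * (((n : ℝ) + x) * r) ^ 2)) * r) : ℝ) : ℂ) * e (-(n * ζ)))
    hu Metric.isOpen_ball (convex_ball (0 : ℝ) (|β| + 1)).isPreconnected
    (fun n x _ => ?_) (fun n x hx => ?_) hmem (summable_zwegersCoeff_mul_e hr c β ζ) hmem
  · have h1 : HasDerivAt (fun x : ℝ => zwegersCoeff r c x n)
        (-(2 * Real.exp (-(Real.pi * (((n : ℝ) + x) * r) ^ 2)) * (1 * r))) x :=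
      (((hasDerivAt_E _).comp x (((hasDerivAt_id x).const_add (n : ℝ)).mul_const r))).const_sub _
    rw [one_mul] at h1
    exact h1.ofReal_comp.mul_const _
  · rw [mem_ball_zero_iff, Real.norm_eq_abs] at hx
    rw [norm_mul, norm_e_neg_mul, Complex.norm_real, Real.norm_eq_abs, abs_neg,
      abs_of_pos (by positivity), Real.exp_add, ← mul_assoc]
    refine mul_le_mul_of_nonneg_right ?_ (Real.exp_pos _).le
    have := mul_le_mul_of_nonneg_left (exp_neg_sq_add_le (r := r) hx.le n)
      (by positivity : 0 ≤ 2 * r)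
    rw [show Real.pi * (((n : ℝ) + x) * r) ^ 2 = Real.pi * r ^ 2 * ((n : ℝ) + x) ^ 2 by ring]
    linarith

/-- Poisson summation for the Gaussian kernel. -/
lemma tsum_gaussKernel {r : ℝ} (hr : 0 < r) (β : ℝ) (ζ : ℂ) :
    ∑' b : ℤ, gaussKernel r β (ζ + b)
      = r * ∑' n : ℤ, (Real.exp (-(Real.pi * (((n : ℝ) + β) * r) ^ 2)) : ℂ) * e (-(n * ζ)) := by
  have hr0 : (r : ℂ) ≠ 0 := Complex.ofReal_ne_zero.2 hr.ne'
  have ha : 0 < ((((r ^ 2)⁻¹ : ℝ) : ℂ)).re := by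
    rw [Complex.ofReal_re]
    positivity
  have hpow : (((r ^ 2)⁻¹ : ℝ) : ℂ) ^ (1 / 2 : ℂ) = (r : ℂ)⁻¹ := by
    rw [show (1 / 2 : ℂ) = ((1 / 2 : ℝ) : ℂ) by push_cast; rfl,
      ← Complex.ofReal_cpow (by positivity), ← Real.sqrt_eq_rpow, Real.sqrt_inv,
      Real.sqrt_sq hr.le, Complex.ofReal_inv]
  have h := Complex.tsum_exp_neg_quadratic ha (-(ζ / r ^ 2) + Complex.I * β)
  rw [hpow] at h
  have hL : ∀ b : ℤ, gaussKernel r β (ζ + b) = gaussKernel r β ζ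
      * Complex.exp (-Real.pi * (((r ^ 2)⁻¹ : ℝ) : ℂ) * b ^ 2
        + 2 * Real.pi * (-(ζ / r ^ 2) + Complex.I * β) * b) := by
    intro b
    rw [gaussKernel, gaussKernel, ← Complex.exp_add]
    congr 1
    push_cast
    field_simp
    ring
  have hR : ∀ n : ℤ, gaussKernel r β ζ * Complex.exp (-Real.pi / (((r ^ 2)⁻¹ : ℝ) : ℂ)
        * ((-n : ℤ) + Complex.I * (-(ζ / r ^ 2) + Complex.I * β)) ^ 2)
      = (Real.exp (-(Real.pi * (((n : ℝ) + β) * r) ^ 2)) : ℂ) * e (-(n * ζ)) := by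
    intro n
    rw [gaussKernel, Complex.ofReal_exp, e, ← Complex.exp_add, ← Complex.exp_add]
    congr 1
    have hI : Complex.I * (-(ζ / r ^ 2) + Complex.I * β) = -(Complex.I * ζ / r ^ 2) - β := by
      linear_combination (β : ℂ) * Complex.I_sq
    rw [hI]
    push_cast
    field_simp
    linear_combination (-ζ ^ 2) * Complex.I_sq
  simp_rw [hL]
  rw [tsum_mul_left, h, ← (Equiv.neg ℤ).tsum_eq]
  simp_rw [Equiv.neg_apply]
  rw [one_div, inv_inv, mul_left_comm, ← tsum_mul_left]
  simp_rw [hR]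

lemma gaussKernel_add_one (r β : ℝ) (ζ : ℂ) (b : ℤ) :
    gaussKernel r (β + 1) (ζ + b) = e ζ * gaussKernel r β (ζ + b) := by
  have : e ζ = e (ζ + b) := by rw [e_add, e_int, mul_one]
  rw [this, gaussKernel, gaussKernel, e, ← Complex.exp_add]
  congr 1
  push_cast
  ring

/-- The jump of the sign shows up as a single term when `β` is shifted by one. -/
lemma zwegersCoeff_add_one (r β : ℝ) (s : ℕ) (n : ℤ) :
    zwegersCoeff r (-s - 1 / 2) (β + 1) n
      = zwegersCoeff r (-s - 1 / 2) β (n + 1) - (if n = s then 2 else 0) := by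
  unfold zwegersCoeff
  rw [show (n : ℝ) + (β + 1) = ((n + 1 : ℤ) : ℝ) + β by push_cast; ring]
  have : Real.sign ((n : ℝ) + (-s - 1 / 2))
      = Real.sign (((n + 1 : ℤ) : ℝ) + (-s - 1 / 2)) - (if n = s then 2 else 0) := by
    rcases lt_trichotomy n (s : ℤ) with h | h | h
    · have h1 : (n : ℝ) + 1 ≤ s := by exact_mod_cast h
      rw [Real.sign_of_neg (by linarith), Real.sign_of_neg (by push_cast; linarith), if_neg h.ne]
      ring
    · subst h
      rw [Real.sign_of_neg (by push_cast; linarith), Real.sign_of_pos (by push_cast; linarith),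
        if_pos rfl]
      ring
    · have h1 : (s : ℝ) + 1 ≤ n := by exact_mod_cast h
      rw [Real.sign_of_pos (by linarith), Real.sign_of_pos (by push_cast; linarith), if_neg h.ne']
      ring
  rw [this]
  ring

/-- Fourier expansion of the periodized damped Cauchy kernel. Both sides have the same derivative
in `β` by Poisson summation, so their difference is constant in `β`; since the difference is also
multiplied by `e ζ ≠ 1` under `β ↦ β + 1`, it vanishes. -/
theorem tsum_gaussKernel_div {r : ℝ} (hr : 0 < r) (β : ℝ) (s : ℕ) {ζ : ℂ} (hζ : e ζ ≠ 1) :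
    -(1 / (2 * Real.pi * Complex.I)) * ∑' b : ℤ, gaussKernel r β (ζ + b) / (ζ + b)
      = e (-(s * ζ)) / (1 - e ζ)
        + 1 / 2 * ∑' n : ℤ, (zwegersCoeff r (-s - 1 / 2) β n : ℂ) * e (-(n * ζ)) := by
  have hpiI : (2 * (Real.pi : ℂ) * Complex.I) ≠ 0 := Complex.two_pi_I_ne_zero
  have hne : ∀ b : ℤ, ζ + b ≠ 0 := by
    intro b hb
    refine hζ ((e_eq_one_iff ζ).2 ⟨-b, ?_⟩)
    rw [eq_neg_of_add_eq_zero_left hb]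
    push_cast
    rfl
  set c : ℝ := -s - 1 / 2 with hc
  let D : ℝ → ℂ := fun β =>
    -(1 / (2 * Real.pi * Complex.I)) * (∑' b : ℤ, gaussKernel r β (ζ + b) / (ζ + b))
      - (e (-(s * ζ)) / (1 - e ζ)
        + 1 / 2 * ∑' n : ℤ, (zwegersCoeff r c β n : ℂ) * e (-(n * ζ)))
  have hD : ∀ β, HasDerivAt D 0 β := by
    intro β
    have h := ((hasDerivAt_tsum_gaussKernel_div hr β hne).const_mul
      (-(1 / (2 * Real.pi * Complex.I)))).sub
      (((hasDerivAt_tsum_zwegersCoeff hr c β ζ).const_mul (1 / 2)).const_add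
        (e (-(s * ζ)) / (1 - e ζ)))
    refine h.congr_deriv ?_
    rw [tsum_mul_left, tsum_gaussKernel hr]
    have : ∀ n : ℤ, ((-(2 * Real.exp (-(Real.pi * (((n : ℝ) + β) * r) ^ 2)) * r) : ℝ) : ℂ)
        * e (-(n * ζ)) = -(2 * r) *
          ((Real.exp (-(Real.pi * (((n : ℝ) + β) * r) ^ 2)) : ℂ) * e (-(n * ζ))) := by
      intro n
      push_cast
      ring
    simp_rw [this]
    rw [tsum_mul_left]
    generalize ∑' n : ℤ, (Real.exp (-(Real.pi * (((n : ℝ) + β) * r) ^ 2)) : ℂ)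
      * e (-(n * ζ)) = S
    field_simp
    ring
  have hconst : D (β + 1) = D β :=
    is_const_of_deriv_eq_zero (fun x => (hD x).differentiableAt) (fun x => (hD x).deriv) _ _
  have hshift : D (β + 1) = e ζ * D β := by
    have h1 : ∑' b : ℤ, gaussKernel r (β + 1) (ζ + b) / (ζ + b)
        = e ζ * ∑' b : ℤ, gaussKernel r β (ζ + b) / (ζ + b) := by
      rw [← tsum_mul_left]
      simp_rw [gaussKernel_add_one, mul_div_assoc]
    have hsum := summable_zwegersCoeff_mul_e hr c β ζ
    have h2 : ∑' n : ℤ, (zwegersCoeff r c (β + 1) n : ℂ) * e (-(n * ζ))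
        = e ζ * (∑' n : ℤ, (zwegersCoeff r c β n : ℂ) * e (-(n * ζ))) - 2 * e (-(s * ζ)) := by
      have hterm : ∀ n : ℤ, (zwegersCoeff r c (β + 1) n : ℂ) * e (-(n * ζ))
          = e ζ * ((zwegersCoeff r c β (n + 1) : ℂ) * e (-((n + 1 : ℤ) * ζ)))
            - (if n = s then 2 * e (-(s * ζ)) else 0) := by
        intro n
        have he : e (-(n * ζ)) = e ζ * e (-((n + 1 : ℤ) * ζ)) := by
          rw [← e_add]
          congr 1
          push_cast
          ring
        rw [hc, zwegersCoeff_add_one, ← hc]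
        split_ifs with hn
        · subst hn
          rw [show (((s : ℕ) : ℤ) : ℂ) = (s : ℂ) by push_cast; rfl] at he ⊢
          push_cast at he ⊢
          linear_combination (zwegersCoeff r c β (s + 1) : ℂ) * he
        · push_cast at he ⊢
          linear_combination (zwegersCoeff r c β (n + 1) : ℂ) * he
      simp_rw [hterm]
      rw [Summable.tsum_sub, tsum_mul_left, tsum_ite_eq]
      · congr 2
        exact (Equiv.addRight (1 : ℤ)).tsum_eq
          fun n : ℤ => (zwegersCoeff r c β n : ℂ) * e (-(n * ζ))
      · exact (((Equiv.addRight (1 : ℤ)).summable_iff).2 hsum).mul_left _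
      · exact (hasSum_ite_eq (s : ℤ) _).summable
    have h1e : 1 - e ζ ≠ 0 := sub_ne_zero.2 (Ne.symm hζ)
    simp only [D]
    rw [h1, h2]
    field_simp
    ring
  have hzero : D β = 0 := by
    have : (1 - e ζ) * D β = 0 := by
      linear_combination hshift - hconst
    exact (mul_eq_zero.1 this).resolve_left (sub_ne_zero.2 (Ne.symm hζ))
  exact sub_eq_zero.1 hzero

/-! ### The lattice sum and its symmetries -/

/-- The summand, indexed by the lattice point `λ = a τ + b`, of the nonholomorphic
Eisenstein–Kronecker type series attached to the index form `M z₁ z₂`. With `ζ = z₁ + λ` it is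
`e (M a z₂) exp (-π M |ζ|² / Im τ) e (-M ζ Im z₂ / Im τ) / ζ`; the two last exponents are merged
into one. -/
noncomputable def latticeTerm (M : ℕ) (τ z₁ z₂ : ℂ) (x : ℤ × ℤ) : ℂ :=
  e (M * x.1 * z₂) * Complex.exp (-(Real.pi * M * (z₁ + x.1 * τ + x.2)
    * (conj (z₁ + x.1 * τ + x.2) + z₂ - conj z₂) / τ.im)) / (z₁ + x.1 * τ + x.2)

/-- The normalized lattice sum, with residue `-1 / (2 π i)` at `z₁ = 0`. -/
noncomputable def latticeSum (M : ℕ) (τ z₁ z₂ : ℂ) : ℂ :=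
  -(1 / (2 * Real.pi * Complex.I)) * ∑' x : ℤ × ℤ, latticeTerm M τ z₁ z₂ x

lemma ofReal_im_eq (z : ℂ) : (z.im : ℂ) = (z - conj z) / (2 * Complex.I) :=
  Complex.im_eq_sub_conj z

lemma sub_conj_ne_zero {τ : ℂ} (hτ : 0 < τ.im) : τ - conj τ ≠ 0 := by
  intro h
  have him := ofReal_im_eq τ
  rw [h, zero_div] at him
  exact hτ.ne' (Complex.ofReal_eq_zero.1 him)

/-- The smallest eigenvalue of a positive definite form is at least determinant over trace. -/
lemma lattice_form_bound (x y a b : ℝ) :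
    y ^ 2 / (x ^ 2 + y ^ 2 + 1) * (a ^ 2 + b ^ 2) ≤ (a * x + b) ^ 2 + (a * y) ^ 2 := by
  rw [div_mul_eq_mul_div, div_le_iff₀ (by positivity)]
  nlinarith [sq_nonneg ((x ^ 2 + y ^ 2) * a + x * b), sq_nonneg (x * a + b)]

lemma exp_norm_lattice_le {p : ℝ} (hp : 0 < p) (τ z : ℂ) (x : ℤ × ℤ) :
    Real.exp (-p * ‖z + x.1 * τ + x.2‖ ^ 2) ≤ Real.exp (p * ‖z‖ ^ 2)
      * Real.exp (-(p * (τ.im ^ 2 / (τ.re ^ 2 + τ.im ^ 2 + 1)) / 2)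
        * ((x.1 : ℝ) ^ 2 + (x.2 : ℝ) ^ 2) + 0 * x.1 + 0 * x.2) := by
  rw [← Real.exp_add, Real.exp_le_exp]
  have h1 := lattice_form_bound τ.re τ.im x.1 x.2
  have h2 : ((x.1 : ℝ) * τ.re + x.2) ^ 2 + ((x.1 : ℝ) * τ.im) ^ 2
      ≤ 2 * (‖z + x.1 * τ + x.2‖ ^ 2 + ‖z‖ ^ 2) := by
    simp only [← Complex.normSq_eq_norm_sq, Complex.normSq_apply, Complex.add_re, Complex.add_im,
      Complex.mul_re, Complex.mul_im, Complex.intCast_re, Complex.intCast_im]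
    nlinarith [sq_nonneg (2 * z.re + (x.1 * τ.re + x.2)), sq_nonneg (2 * z.im + x.1 * τ.im)]
  have h3 := mul_le_mul_of_nonneg_left (h1.trans h2) hp.le
  linarith

lemma norm_latticeTerm {τ : ℂ} (hτ : 0 < τ.im) (M : ℕ) (z₁ z₂ : ℂ) (x : ℤ × ℤ) :
    ‖latticeTerm M τ z₁ z₂ x‖ = Real.exp (2 * Real.pi * M * z₁.im * z₂.im / τ.im)
      * Real.exp (-(Real.pi * M / τ.im) * ‖z₁ + x.1 * τ + x.2‖ ^ 2)
      / ‖z₁ + x.1 * τ + x.2‖ := by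
  rw [latticeTerm, norm_div, norm_mul, norm_e, Complex.norm_exp, ← Real.exp_add, ← Real.exp_add]
  congr 2
  have hre : (Real.pi * M * (z₁ + x.1 * τ + x.2)
      * (conj (z₁ + x.1 * τ + x.2) + z₂ - conj z₂) / τ.im : ℂ)
      = ((Real.pi * M / τ.im : ℝ) : ℂ) * ((Complex.normSq (z₁ + x.1 * τ + x.2) : ℂ)
        + ((2 * z₂.im : ℝ) : ℂ) * (Complex.I * (z₁ + x.1 * τ + x.2))) := by
    rw [Complex.normSq_eq_conj_mul_self]
    have : z₂ - conj z₂ = ((2 * z₂.im : ℝ) : ℂ) * Complex.I := by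
      push_cast
      rw [ofReal_im_eq]
      field_simp
    rw [add_sub_assoc, this]
    push_cast
    ring
  rw [Complex.neg_re, hre, Complex.re_ofReal_mul, Complex.add_re, Complex.ofReal_re,
    Complex.re_ofReal_mul, Complex.I_mul_re, Complex.normSq_eq_norm_sq]
  have him : (z₁ + x.1 * τ + x.2).im = z₁.im + x.1 * τ.im := by simp
  have him2 : ((M : ℂ) * x.1 * z₂).im = M * x.1 * z₂.im := by
    rw [show (M : ℂ) * x.1 * z₂ = (((M : ℝ) * x.1 : ℝ) : ℂ) * z₂ by push_cast; ring,
      Complex.im_ofReal_mul]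
  rw [him, him2]
  field_simp
  ring

lemma summable_latticeTerm {τ : ℂ} (hτ : 0 < τ.im) {M : ℕ} (hM : 0 < M) (z₁ z₂ : ℂ) :
    Summable (latticeTerm M τ z₁ z₂) := by
  have hM' : (0 : ℝ) < M := Nat.cast_pos.2 hM
  have hp : 0 < Real.pi * M / τ.im := by have := Real.pi_pos; positivity
  have hG : Summable fun x : ℤ × ℤ =>
      Real.exp (-(Real.pi * M / τ.im) * ‖z₁ + x.1 * τ + x.2‖ ^ 2) := by
    have h : Summable fun x : ℤ × ℤ =>
        ((Real.exp (-(Real.pi * M / τ.im) * ‖z₁ + x.1 * τ + x.2‖ ^ 2) : ℝ) : ℂ) := by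
      refine summable_of_norm_le_exp_quadratic
        (p := Real.pi * M / τ.im * (τ.im ^ 2 / (τ.re ^ 2 + τ.im ^ 2 + 1)) / 2)
        (K := Real.exp (Real.pi * M / τ.im * ‖z₁‖ ^ 2)) (by positivity) 0 0 fun x => ?_
      rw [Complex.norm_real, Real.norm_eq_abs, Real.abs_exp]
      exact exp_norm_lattice_le hp τ z₁ x
    exact Complex.summable_ofReal.1 h
  refine Summable.of_norm_bounded_eventually
    (hG.mul_left (Real.exp (2 * Real.pi * M * z₁.im * z₂.im / τ.im))) ?_
  filter_upwards [eventually_one_le_norm hp hG] with x hx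
  rw [norm_latticeTerm hτ]
  exact div_le_self (by positivity) hx

/-- Multiplying the summand by `e n` with `n` an integer does nothing; this absorbs the integer
ambiguities in the exponents below. -/
lemma mul_e_int (u : ℂ) (n : ℤ) : u * e n = u := by rw [e_int, mul_one]

lemma latticeSum_eq_of_reindex {M : ℕ} {τ τ' z₁ z₁' z₂ z₂' c : ℂ} (σ : ℤ × ℤ ≃ ℤ × ℤ)
    (h : ∀ x, latticeTerm M τ' z₁' z₂' x = c * latticeTerm M τ z₁ z₂ (σ x)) :
    latticeSum M τ' z₁' z₂' = c * latticeSum M τ z₁ z₂ := by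
  rw [latticeSum, latticeSum, tsum_congr h, tsum_mul_left,
    σ.tsum_eq (latticeTerm M τ z₁ z₂)]
  ring

/-- The rotation `(a, b) ↦ (b, -a)` of the lattice indices induced by `S`. -/
def latticeRot : ℤ × ℤ ≃ ℤ × ℤ where
  toFun x := (x.2, -x.1)
  invFun x := (-x.2, x.1)
  left_inv x := by simp
  right_inv x := by simp

/-- The shear `(a, b) ↦ (a, a + b)` of the lattice indices induced by `T`. -/
def latticeShear : ℤ × ℤ ≃ ℤ × ℤ where
  toFun x := (x.1, x.1 + x.2)
  invFun x := (x.1, x.2 - x.1)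
  left_inv x := by simp
  right_inv x := by simp

theorem latticeSum_S {τ : ℂ} (hτ : 0 < τ.im) (M : ℕ) (z₁ z₂ : ℂ) :
    latticeSum M (-1 / τ) (z₁ / τ) (z₂ / τ)
      = τ * e (M * z₁ * z₂ / τ) * latticeSum M τ z₁ z₂ := by
  have h0 : τ ≠ 0 := by
    rintro rfl
    simp at hτ
  have h0' : conj τ ≠ 0 := (map_ne_zero _).2 h0
  have hsub := sub_conj_ne_zero hτ
  refine latticeSum_eq_of_reindex latticeRot fun x => ?_
  obtain ⟨a, b⟩ := x
  simp only [latticeRot, Equiv.coe_fn_mk, latticeTerm]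
  have hζ : z₁ / τ + a * (-1 / τ) + b = (z₁ + b * τ + (-a : ℤ)) / τ := by
    push_cast
    field_simp
    ring
  rw [hζ]
  generalize hw : z₁ + b * τ + ((-a : ℤ) : ℂ) = ζ
  have hexp : e (M * a * (z₂ / τ)) * Complex.exp (-(Real.pi * M * (ζ / τ)
        * (conj (ζ / τ) + z₂ / τ - conj (z₂ / τ)) / ((-1 / τ).im : ℂ)))
      = e (M * z₁ * z₂ / τ) * (e (M * b * z₂)
        * Complex.exp (-(Real.pi * M * ζ * (conj ζ + z₂ - conj z₂) / τ.im))) := by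
    have ha : (a : ℂ) = z₁ + b * τ - ζ := by
      rw [← hw]
      push_cast
      ring
    simp only [e, ← Complex.exp_add]
    congr 1
    rw [ofReal_im_eq, ofReal_im_eq, ha]
    simp only [map_div₀, map_neg, map_one]
    have hsub' : (-1 / τ - -1 / conj τ) ≠ 0 := by
      rw [show -1 / τ - -1 / conj τ = (τ - conj τ) / (τ * conj τ) by field_simp; ring]
      exact div_ne_zero hsub (mul_ne_zero h0 h0')
    rw [show -1 / τ - -1 / conj τ = (τ - conj τ) / (τ * conj τ) by field_simp; ring]
    field_simp
    ring
  rw [hexp]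
  rw [div_div_eq_mul_div]
  ring

theorem latticeSum_T (M : ℕ) (τ z₁ z₂ : ℂ) :
    latticeSum M (τ + 1) z₁ z₂ = latticeSum M τ z₁ z₂ := by
  rw [← one_mul (latticeSum M τ z₁ z₂)]
  refine latticeSum_eq_of_reindex latticeShear fun x => ?_
  obtain ⟨a, b⟩ := x
  simp only [latticeShear, Equiv.coe_fn_mk, latticeTerm, one_mul]
  rw [show z₁ + a * (τ + 1) + b = z₁ + a * τ + (a + b : ℤ) by push_cast; ring]
  simp

theorem latticeSum_add_int_left (M : ℕ) (τ z₁ z₂ : ℂ) (c : ℤ) :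
    latticeSum M τ (z₁ + c) z₂ = latticeSum M τ z₁ z₂ := by
  rw [← one_mul (latticeSum M τ z₁ z₂)]
  refine latticeSum_eq_of_reindex ((Equiv.refl ℤ).prodCongr (Equiv.addRight c)) fun x => ?_
  obtain ⟨a, b⟩ := x
  simp only [Equiv.prodCongr_apply, Prod.map, Equiv.refl_apply, Equiv.coe_addRight,
    latticeTerm, one_mul]
  rw [show z₁ + c + a * τ + b = z₁ + a * τ + (b + c : ℤ) by push_cast; ring]

theorem latticeSum_add_int_right (M : ℕ) (τ z₁ z₂ : ℂ) (d : ℤ) :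
    latticeSum M τ z₁ (z₂ + d) = latticeSum M τ z₁ z₂ := by
  rw [← one_mul (latticeSum M τ z₁ z₂)]
  refine latticeSum_eq_of_reindex (Equiv.refl _) fun x => ?_
  obtain ⟨a, b⟩ := x
  simp only [Equiv.refl_apply, latticeTerm, one_mul]
  have h : e (M * a * (z₂ + d)) = e (M * a * z₂) := by
    rw [← mul_e_int (e (M * a * z₂)) (M * a * d), ← e_add]
    congr 1
    push_cast
    ring
  have hd : conj (z₂ + d) = conj z₂ + d := by rw [map_add, map_intCast]
  rw [h, hd, ← add_assoc, add_sub_add_right_eq_sub]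

theorem latticeSum_add_mul_left (M : ℕ) (τ z₁ z₂ : ℂ) (c : ℤ) :
    latticeSum M τ (z₁ + c * τ) z₂ = e (-(M * c * z₂)) * latticeSum M τ z₁ z₂ := by
  refine latticeSum_eq_of_reindex ((Equiv.addRight c).prodCongr (Equiv.refl ℤ)) fun x => ?_
  obtain ⟨a, b⟩ := x
  simp only [Equiv.prodCongr_apply, Prod.map, Equiv.refl_apply, Equiv.coe_addRight, latticeTerm]
  rw [show z₁ + c * τ + a * τ + b = z₁ + (a + c : ℤ) * τ + b by push_cast; ring,
    show (M * a * z₂ : ℂ) = -(M * c * z₂) + M * (a + c : ℤ) * z₂ by push_cast; ring, e_add]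
  ring

theorem latticeSum_add_mul_right {τ : ℂ} (hτ : 0 < τ.im) (M : ℕ) (z₁ z₂ : ℂ) (d : ℤ) :
    latticeSum M τ z₁ (z₂ + d * τ) = e (-(M * d * z₁)) * latticeSum M τ z₁ z₂ := by
  have hsub := sub_conj_ne_zero hτ
  refine latticeSum_eq_of_reindex (Equiv.refl _) fun x => ?_
  obtain ⟨a, b⟩ := x
  simp only [Equiv.refl_apply, latticeTerm]
  rw [← mul_div_assoc]
  congr 1
  rw [← mul_e_int (_ * _) (M * d * b)]
  simp only [e, ← Complex.exp_add]
  congr 1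
  rw [ofReal_im_eq]
  simp only [map_add, map_mul, map_intCast]
  push_cast
  field_simp
  ring

/-- Both elliptic shifts by multiples of `τ` at once. -/
theorem latticeSum_add_mul {τ : ℂ} (hτ : 0 < τ.im) (M : ℕ) (z₁ z₂ : ℂ) (c d : ℤ) :
    latticeSum M τ (z₁ + c * τ) (z₂ + d * τ)
      = e (-(M * c * d * τ)) * e (-(M * (d * z₁ + c * z₂))) * latticeSum M τ z₁ z₂ := by
  rw [latticeSum_add_mul_left, latticeSum_add_mul_right hτ, ← mul_assoc, ← e_add, ← e_add]
  congr 2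
  ring

/-! ### Theta functions and the nonholomorphic series -/

lemma summable_thetaTerm {M : ℕ} (hM : 0 < M) {τ : ℂ} (hτ : 0 < τ.im) (j : ℤ) (z : ℂ) :
    Summable (thetaTerm j M τ z) := by
  have hM' : (0 : ℝ) < M := Nat.cast_pos.2 hM
  have hp : 0 < 2 * Real.pi * M * τ.im := by have := Real.pi_pos; positivity
  set x : ℝ := j / (2 * M) with hx
  refine Summable.of_norm_bounded ((summable_exp_quadratic hp
    (-(2 * Real.pi * M * (z.im + 2 * x * τ.im)))).mul_left
      (Real.exp (-(2 * Real.pi * M * (z.im * x + x ^ 2 * τ.im))))) fun n => ?_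
  rw [thetaTerm, norm_mul, norm_e, norm_e, ← Real.exp_add, ← Real.exp_add]
  have h1 : ((M : ℂ) * z * (n + j / (2 * M))).im = M * (n + x) * z.im := by
    rw [show (M : ℂ) * z * (n + j / (2 * M)) = ((M * (n + x) : ℝ) : ℂ) * z by
      rw [hx]; push_cast; ring, Complex.im_ofReal_mul]
  have h2 : ((M : ℂ) * (n + j / (2 * M)) ^ 2 * τ).im = M * (n + x) ^ 2 * τ.im := by
    rw [show (M : ℂ) * (n + j / (2 * M)) ^ 2 * τ = ((M * (n + x) ^ 2 : ℝ) : ℂ) * τ by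
      rw [hx]; push_cast; ring, Complex.im_ofReal_mul]
  rw [h1, h2]
  refine le_of_eq (congrArg Real.exp ?_)
  ring

lemma Theta_congr {M : ℕ} (hM : 0 < M) {j j' : ℤ} (h : j ≡ j' [ZMOD 2 * (M : ℤ)]) (τ z : ℂ) :
    Theta j M τ z = Theta j' M τ z := by
  obtain ⟨k, hk⟩ := h.dvd
  have hM' : (M : ℂ) ≠ 0 := Nat.cast_ne_zero.2 hM.ne'
  rw [Theta, Theta, ← (Equiv.addRight k).tsum_eq (thetaTerm j M τ z)]
  refine tsum_congr fun n => ?_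
  have : ((Equiv.addRight k n : ℤ) : ℂ) + j / (2 * M) = n + j' / (2 * M) := by
    rw [eq_add_of_sub_eq hk, Equiv.coe_addRight]
    push_cast
    field_simp
    ring
  rw [thetaTerm, thetaTerm, this]

lemma Theta_neg_right (j : ℤ) (M : ℕ) (τ z : ℂ) : Theta j M τ (-z) = Theta (-j) M τ z := by
  rw [Theta, Theta, ← (Equiv.neg ℤ).tsum_eq (thetaTerm j M τ (-z))]
  refine tsum_congr fun n => ?_
  rw [thetaTerm, thetaTerm, Equiv.neg_apply]
  congr 2
  · push_cast
    ring
  · push_cast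
    ring

lemma norm_RTerm_eq (j : ℤ) {M : ℕ} (τ v : ℂ) (n : ℤ) :
    ‖RTerm j M τ v n‖ = |zwegersCoeff (Real.sqrt (τ.im / M)) (1 / 2 + j - 2 * M)
        (2 * M * (v.im / τ.im)) n|
      * Real.exp (Real.pi * τ.im / (2 * M) * (n : ℝ) ^ 2 + 2 * Real.pi * v.im * n) := by
  rw [RTerm, norm_mul, Complex.norm_real, Real.norm_eq_abs, Complex.norm_exp, zwegersCoeff]
  congr 2
  · congr 2
    ring_nf
  · rw [show -((Real.pi : ℂ) * Complex.I * n ^ 2 / (2 * M) * τ)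
        - 2 * Real.pi * Complex.I * n * v
        = ((-(Real.pi * n ^ 2 / (2 * M)) : ℝ) : ℂ) * (Complex.I * τ)
          + ((-(2 * Real.pi * n) : ℝ) : ℂ) * (Complex.I * v) by push_cast; ring,
      Complex.add_re, Complex.re_ofReal_mul, Complex.re_ofReal_mul, Complex.I_mul_re,
      Complex.I_mul_re]
    ring

/-- The Gaussian decay `exp (-π y n² / M)` of the coefficients beats the growth
`exp (π y n² / (2 M))` of the exponential factor. -/
lemma summable_RTerm (j : ℤ) {M : ℕ} (hM : 0 < M) {τ : ℂ} (hτ : 0 < τ.im) (v : ℂ) :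
    Summable (RTerm j M τ v) := by
  have hM' : (0 : ℝ) < M := Nat.cast_pos.2 hM
  have hpi := Real.pi_pos
  have hr : 0 < Real.sqrt (τ.im / M) := Real.sqrt_pos.2 (by positivity)
  have hr2 : Real.sqrt (τ.im / M) ^ 2 = τ.im / M := Real.sq_sqrt (by positivity)
  set c : ℝ := 1 / 2 + j - 2 * M
  set β : ℝ := 2 * M * (v.im / τ.im)
  refine Summable.of_norm_bounded ((summable_exp_quadratic
    (p := Real.pi * τ.im / (2 * M)) (by positivity)
    (2 * Real.pi * v.im - 2 * Real.pi * (τ.im / M) * β)).mul_left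
      (2 * Real.exp (Real.pi * (τ.im / M) * (c - β) ^ 2)
        * Real.exp (-(Real.pi * (τ.im / M) * β ^ 2)))) fun n => ?_
  rw [norm_RTerm_eq]
  have h := abs_zwegersCoeff_le hr c β n
  rw [hr2] at h
  refine (mul_le_mul_of_nonneg_right h (Real.exp_pos _).le).trans (le_of_eq ?_)
  rw [mul_assoc, mul_assoc (2 * Real.exp _), ← Real.exp_add, ← Real.exp_add]
  congr 2
  field_simp
  ring

lemma tsum_residue_classes {N : ℤ} (hN : 0 < N) (k : ℤ) {f : ℤ → ℂ} (hf : Summable f) :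
    ∑ j ∈ Finset.Icc k (k + N - 1), ∑' n : {n : ℤ // n ≡ -j [ZMOD N]}, f n.1 = ∑' n, f n := by
  have h1 : ∀ j : ℤ, ∑' n : {n : ℤ // n ≡ -j [ZMOD N]}, f n.1
      = ∑' n : ℤ, Set.indicator {n : ℤ | n ≡ -j [ZMOD N]} f n :=
    fun j => tsum_subtype {n : ℤ | n ≡ -j [ZMOD N]} f
  simp_rw [h1]
  rw [← Summable.tsum_finsetSum fun j _ => hf.indicator _]
  refine tsum_congr fun n => ?_
  have hnn := Int.emod_nonneg (-n - k) hN.ne'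
  have hlt := Int.emod_lt_of_pos (-n - k) hN
  rw [Finset.sum_eq_single (k + (-n - k) % N)]
  · rw [Set.indicator_of_mem]
    have h := (Int.mod_modEq (-n - k) N).add_left k
    have h2 := h.neg.symm
    simpa using h2
  · intro j hj hne
    rw [Set.indicator_of_notMem]
    intro hmem
    apply hne
    have h3 : j - k ≡ -n - k [ZMOD N] := by
      have := (Int.ModEq.neg hmem).symm
      rw [neg_neg] at this
      exact this.sub_right k
    rw [Finset.mem_Icc] at hj
    have h4 : (j - k) % N = j - k := Int.emod_eq_of_lt (by omega) (by omega)
    rw [← h3.eq, h4]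
    ring
  · intro hnot
    exact absurd (Finset.mem_Icc.2 ⟨by omega, by omega⟩) hnot

/-- For `n` in the residue class of `-j`, `-s ≤ j ≤ -s + 2M - 1`, the sign occurring in `R_{j;M}`
depends on `n` and `s` only. -/
lemma sign_eq_of_modEq {M s : ℕ} {j n : ℤ} (hn : n ≡ -j [ZMOD 2 * (M : ℤ)])
    (hj : j ∈ Finset.Icc (-(s : ℤ)) (-(s : ℤ) + 2 * (M : ℤ) - 1)) :
    Real.sign ((n : ℝ) + 1 / 2 + (j : ℝ) - 2 * (M : ℝ)) = Real.sign ((n : ℝ) + (-s - 1 / 2)) := by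
  obtain ⟨k, hk⟩ := hn.symm.dvd
  rw [Finset.mem_Icc] at hj
  have hn' : (n : ℝ) = 2 * M * k - j := by
    have : n = 2 * M * k - j := by linarith
    exact_mod_cast this
  have h1 : (-(s : ℝ)) ≤ j := by exact_mod_cast hj.1
  have h2 : (j : ℝ) ≤ -s + 2 * M - 1 := by exact_mod_cast hj.2
  have hM0 : (0 : ℝ) ≤ M := Nat.cast_nonneg M
  rcases le_or_gt 1 k with h | h
  · have hk1 : (1 : ℝ) ≤ k := by exact_mod_cast h
    have := mul_le_mul_of_nonneg_left hk1 hM0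
    rw [Real.sign_of_pos (by linarith), Real.sign_of_pos (by linarith)]
  · have hk0 : (k : ℝ) ≤ 0 := by exact_mod_cast (by omega : k ≤ 0)
    have := mul_le_mul_of_nonneg_left hk0 hM0
    have hM1 : (1 : ℝ) ≤ 2 * M := by linarith
    rw [Real.sign_of_neg (by linarith), Real.sign_of_neg (by linarith)]

/-! ### The completed Appell function as a lattice sum -/

/-- The summand of the double series of the product `Σ_j R_j Θ_j`, with the sum over `n` taken
over all integers. -/
noncomputable def correctionTerm (M s : ℕ) (τ z₁ z₂ : ℂ) (x : ℤ × ℤ) : ℂ :=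
  e (M * x.1 * (z₁ + z₂) + M * x.1 ^ 2 * τ)
    * ((zwegersCoeff (Real.sqrt (τ.im / M)) (-s - 1 / 2)
        (2 * M * (((z₁ - z₂) / 2).im / τ.im)) x.2 : ℂ) * e (-(x.2 * (z₁ + x.1 * τ))))

/-- After the Gaussian bound on the coefficients the exponent is, up to linear terms,
`-π y (n² / M - 2 n a + 2 M a²)`, a negative definite form. -/
lemma summable_correctionTerm {M : ℕ} (hM : 0 < M) (s : ℕ) {τ : ℂ} (hτ : 0 < τ.im) (z₁ z₂ : ℂ) :
    Summable (correctionTerm M s τ z₁ z₂) := by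
  have hM' : (0 : ℝ) < M := Nat.cast_pos.2 hM
  have hM1 : (1 : ℝ) ≤ M := Nat.one_le_cast.2 hM
  have hpi := Real.pi_pos
  have hr : 0 < Real.sqrt (τ.im / M) := Real.sqrt_pos.2 (by positivity)
  have hr2 : Real.sqrt (τ.im / M) ^ 2 = τ.im / M := Real.sq_sqrt (by positivity)
  set c : ℝ := -s - 1 / 2 with hc
  set β : ℝ := 2 * M * (((z₁ - z₂) / 2).im / τ.im) with hβ
  refine summable_of_norm_le_exp_quadratic (p := Real.pi * τ.im / (3 * M))
    (K := 2 * Real.exp (Real.pi * (τ.im / M) * (c - β) ^ 2)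
        * Real.exp (-(Real.pi * (τ.im / M) * β ^ 2))) (by positivity)
    (-(2 * Real.pi * M * (z₁ + z₂).im))
    (2 * Real.pi * z₁.im - 2 * Real.pi * (τ.im / M) * β) fun x => ?_
  obtain ⟨a, n⟩ := x
  rw [correctionTerm, norm_mul, norm_mul, norm_e, norm_e_neg_mul, Complex.norm_real,
    Real.norm_eq_abs, ← hc, ← hβ]
  have h := abs_zwegersCoeff_le hr c β n
  rw [hr2] at h
  have him1 : ((M : ℂ) * a * (z₁ + z₂) + M * a ^ 2 * τ).im
      = M * a * (z₁ + z₂).im + M * a ^ 2 * τ.im := by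
    rw [show (M : ℂ) * a * (z₁ + z₂) + M * a ^ 2 * τ
      = ((M * a : ℝ) : ℂ) * (z₁ + z₂) + ((M * a ^ 2 : ℝ) : ℂ) * τ by push_cast; ring,
      Complex.add_im, Complex.im_ofReal_mul, Complex.im_ofReal_mul]
  have him2 : (z₁ + a * τ).im = z₁.im + a * τ.im := by simp
  rw [him1, him2]
  have hform : ((a : ℝ) ^ 2 + (n : ℝ) ^ 2) / 3
      ≤ (n : ℝ) ^ 2 - 2 * (n * (M * a)) + 2 * (M * a) ^ 2 := by
    have : (a : ℝ) ^ 2 ≤ (M * a) ^ 2 := by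
      rw [mul_pow]
      exact le_mul_of_one_le_left (sq_nonneg _) (one_le_pow₀ hM1)
    nlinarith [sq_nonneg (2 * (n : ℝ) - 3 * (M * a))]
  have hform2 := mul_le_mul_of_nonneg_left hform
    (by positivity : 0 ≤ Real.pi * τ.im / M)
  calc _ ≤ Real.exp (-(2 * Real.pi * (M * a * (z₁ + z₂).im + M * a ^ 2 * τ.im)))
        * ((2 * Real.exp (Real.pi * (τ.im / M) * (c - β) ^ 2)
          * Real.exp (-(Real.pi * (τ.im / M) * (n + β) ^ 2)))
            * Real.exp (2 * Real.pi * (z₁.im + a * τ.im) * n)) := by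
        gcongr
    _ = 2 * Real.exp (Real.pi * (τ.im / M) * (c - β) ^ 2)
          * Real.exp (-(2 * Real.pi * (M * a * (z₁ + z₂).im + M * a ^ 2 * τ.im))
            + -(Real.pi * (τ.im / M) * (n + β) ^ 2) + 2 * Real.pi * (z₁.im + a * τ.im) * n) := by
        rw [Real.exp_add, Real.exp_add]
        ring
    _ ≤ _ := by
        rw [mul_assoc (2 * Real.exp _) (Real.exp _) (Real.exp _), ← Real.exp_add]
        refine mul_le_mul_of_nonneg_left (Real.exp_le_exp.2 ?_) (by positivity)
        have hl : Real.pi * τ.im / M * (((a : ℝ) ^ 2 + (n : ℝ) ^ 2) / 3)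
            = Real.pi * τ.im / (3 * M) * ((a : ℝ) ^ 2 + (n : ℝ) ^ 2) := by
          field_simp
        have hr : Real.pi * τ.im / M * ((n : ℝ) ^ 2 - 2 * (n * (M * a)) + 2 * (M * a) ^ 2)
            = Real.pi * (τ.im / M) * n ^ 2 - 2 * Real.pi * a * τ.im * n
              + 2 * Real.pi * (M * a ^ 2 * τ.im) := by
          field_simp
        rw [hl, hr] at hform2
        simp only
        linarith

/-- The double series is the product sum `Σ_j R_j Θ_j`. -/
lemma tsum_correctionTerm {M : ℕ} (hM : 0 < M) (s : ℕ) {τ : ℂ} (hτ : 0 < τ.im) (z₁ z₂ : ℂ) :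
    ∑' x, correctionTerm M s τ z₁ z₂ x
      = ∑ j ∈ Finset.Icc (-(s : ℤ)) (-(s : ℤ) + 2 * (M : ℤ) - 1),
          R j M τ ((z₁ - z₂) / 2) * Theta j M τ (z₁ + z₂) := by
  have hM' : (M : ℂ) ≠ 0 := Nat.cast_ne_zero.2 hM.ne'
  have hsum := summable_correctionTerm hM s hτ z₁ z₂
  have hswap := (Equiv.prodComm ℤ ℤ).summable_iff.2 hsum
  have hrow : Summable fun n : ℤ => ∑' a : ℤ, correctionTerm M s τ z₁ z₂ (a, n) := hswap.prod
  have hfub : ∑' x, correctionTerm M s τ z₁ z₂ x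
      = ∑' n : ℤ, ∑' a : ℤ, correctionTerm M s τ z₁ z₂ (a, n) :=
    ((Equiv.prodComm ℤ ℤ).tsum_eq _).symm.trans hswap.tsum_prod
  rw [hfub, ← tsum_residue_classes (by positivity : (0 : ℤ) < 2 * M) (-(s : ℤ)) hrow]
  refine Finset.sum_congr rfl fun j hj => ?_
  rw [R, ← tsum_mul_right]
  refine tsum_congr fun n => ?_
  obtain ⟨n, hn⟩ := n
  have hcong : j ≡ -n [ZMOD 2 * (M : ℤ)] := by
    have := (Int.ModEq.neg hn).symm
    rwa [neg_neg] at this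
  rw [Theta_congr hM hcong, Theta, ← tsum_mul_left]
  refine tsum_congr fun a => ?_
  have hexp : e (M * a * (z₁ + z₂) + M * a ^ 2 * τ) * e (-(n * (z₁ + a * τ)))
      = Complex.exp (-(Real.pi * Complex.I * n ^ 2 / (2 * M) * τ)
          - 2 * Real.pi * Complex.I * n * ((z₁ - z₂) / 2))
        * (e (M * (z₁ + z₂) * (a + (-n : ℤ) / (2 * M)))
          * e (M * (a + (-n : ℤ) / (2 * M)) ^ 2 * τ)) := by
    simp only [e, ← Complex.exp_add]
    congr 1
    push_cast
    field_simp
    ring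
  rw [correctionTerm, RTerm, thetaTerm, sign_eq_of_modEq hn hj, zwegersCoeff, mul_left_comm,
    hexp]
  ring

/-- Each row of the lattice sum is a periodized Gaussian kernel. -/
lemma latticeTerm_eq_gaussKernel {M : ℕ} (hM : 0 < M) {τ : ℂ} (hτ : 0 < τ.im) (z₁ z₂ : ℂ)
    (a b : ℤ) :
    latticeTerm M τ z₁ z₂ (a, b) = e (M * a * (z₁ + z₂) + M * a ^ 2 * τ)
      * (gaussKernel (Real.sqrt (τ.im / M)) (2 * M * (((z₁ - z₂) / 2).im / τ.im))
        (z₁ + a * τ + b) / (z₁ + a * τ + b)) := by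
  have hM' : (M : ℂ) ≠ 0 := Nat.cast_ne_zero.2 hM.ne'
  have hsub := sub_conj_ne_zero hτ
  have hr2 : ((Real.sqrt (τ.im / M) : ℝ) : ℂ) ^ 2 = τ.im / M := by
    rw [← Complex.ofReal_pow, Real.sq_sqrt (by positivity)]
    push_cast
    rfl
  rw [latticeTerm, gaussKernel, hr2, ← mul_div_assoc]
  congr 1
  rw [← mul_e_int (e (M * a * (z₁ + z₂) + M * a ^ 2 * τ) * _) (M * a * b)]
  simp only [e, ← Complex.exp_add]
  congr 1
  push_cast
  rw [ofReal_im_eq τ, ofReal_im_eq]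
  simp only [map_add, map_mul, map_sub, map_div₀, map_intCast, map_ofNat]
  field_simp
  ring

/-- The key identity: the completed Appell function is a lattice sum. -/
theorem Phi1_add_correction (m s : ℕ) {τ z₁ : ℂ} (z₂ : ℂ) (hτ : 0 < τ.im)
    (hz₁ : ∀ k l : ℤ, z₁ ≠ (k : ℂ) + (l : ℂ) * τ) :
    Summable (Phi1Term m s τ z₁ z₂) ∧
    Phi1 m s τ z₁ z₂ + 1 / 2 * ∑ j ∈ Finset.Icc (-(s : ℤ)) (-(s : ℤ) + 2 * (m : ℤ) + 1),
      R j (m + 1) τ ((z₁ - z₂) / 2) * Theta j (m + 1) τ (z₁ + z₂)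
      = latticeSum (m + 1) τ z₁ z₂ := by
  have hM : 0 < m + 1 := m.succ_pos
  have hr : 0 < Real.sqrt (τ.im / (m + 1 : ℕ)) := Real.sqrt_pos.2 (by positivity)
  have hL := summable_latticeTerm hτ hM z₁ z₂
  have hC := summable_correctionTerm hM s hτ z₁ z₂
  have hrow : ∀ a : ℤ, -(1 / (2 * Real.pi * Complex.I))
        * ∑' b : ℤ, latticeTerm (m + 1) τ z₁ z₂ (a, b)
      = Phi1Term m s τ z₁ z₂ a
        + 1 / 2 * ∑' n : ℤ, correctionTerm (m + 1) s τ z₁ z₂ (a, n) := by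
    intro a
    have hne : e (z₁ + a * τ) ≠ 1 := by
      intro h
      obtain ⟨k, hk⟩ := (e_eq_one_iff _).1 h
      refine hz₁ k (-a) ?_
      rw [← hk]
      push_cast
      ring
    have h := tsum_gaussKernel_div hr
      (2 * (m + 1 : ℕ) * (((z₁ - z₂) / 2).im / τ.im)) s hne
    simp_rw [latticeTerm_eq_gaussKernel hM hτ, correctionTerm]
    rw [tsum_mul_left, tsum_mul_left, mul_left_comm, h, mul_add, mul_left_comm _ (1 / 2 : ℂ)]
    congr 1
    rw [Phi1Term, ← e_add z₁, ← mul_div_assoc]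
    congr 1
    simp only [← e_add]
    congr 1
    push_cast
    ring
  have hP : Phi1Term m s τ z₁ z₂ = fun a : ℤ => -(1 / (2 * Real.pi * Complex.I))
        * (∑' b : ℤ, latticeTerm (m + 1) τ z₁ z₂ (a, b))
        - 1 / 2 * ∑' n : ℤ, correctionTerm (m + 1) s τ z₁ z₂ (a, n) := by
    funext a
    rw [hrow]
    ring
  have hL1 := hL.prod.mul_left (-(1 / (2 * Real.pi * Complex.I)))
  have hC1 := hC.prod.mul_left (1 / 2)
  refine ⟨hP ▸ hL1.sub hC1, ?_⟩
  have hc := tsum_correctionTerm hM s hτ z₁ z₂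
  rw [show -(s : ℤ) + 2 * ((m + 1 : ℕ) : ℤ) - 1 = -(s : ℤ) + 2 * (m : ℤ) + 1 by
    push_cast; ring] at hc
  rw [← hc, Phi1, latticeSum, hL.tsum_prod, hC.tsum_prod, hP, hL1.tsum_sub hC1, tsum_mul_left,
    tsum_mul_left]
  ring

/-- The modified numerator is the antisymmetrization of the lattice sum. -/
theorem PhiTilde_eq_latticeSum (m s : ℕ) {τ z₁ z₂ : ℂ} (t : ℂ) (hτ : 0 < τ.im)
    (hz₁ : ∀ k l : ℤ, z₁ ≠ (k : ℂ) + (l : ℂ) * τ)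
    (hz₂ : ∀ k l : ℤ, z₂ ≠ (k : ℂ) + (l : ℂ) * τ) :
    PhiTilde m s τ z₁ z₂ t = e (((m : ℂ) + 1) * t)
      * (latticeSum (m + 1) τ z₁ z₂ - latticeSum (m + 1) τ (-z₂) (-z₁)) := by
  have hz₂' : ∀ k l : ℤ, -z₂ ≠ (k : ℂ) + (l : ℂ) * τ := by
    intro k l h
    refine hz₂ (-k) (-l) ?_
    rw [← neg_neg z₂, h]
    push_cast
    ring
  have h1 := (Phi1_add_correction m s z₂ hτ hz₁).2
  have h2 := (Phi1_add_correction m s (-z₁) hτ hz₂').2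
  rw [show (-z₂ - -z₁) / 2 = (z₁ - z₂) / 2 by ring, show -z₂ + -z₁ = -(z₁ + z₂) by ring] at h2
  simp_rw [Theta_neg_right] at h2
  rw [← h1, ← h2, PhiTilde, Phi, PhiAdd]
  simp_rw [mul_sub, Finset.sum_sub_distrib]
  ring

/-! ### Avoiding the poles -/

lemma im_neg_one_div_pos {τ : ℂ} (hτ : 0 < τ.im) : 0 < (-1 / τ).im := by
  have h0 : τ ≠ 0 := by
    rintro rfl
    simp at hτ
  rw [neg_div, one_div, Complex.neg_im, Complex.inv_im, neg_div, neg_neg]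
  exact div_pos hτ (Complex.normSq_pos.2 h0)

lemma div_notMem_lattice {τ z : ℂ} (h0 : τ ≠ 0)
    (hz : ∀ k l : ℤ, z ≠ (k : ℂ) + (l : ℂ) * τ) (k l : ℤ) :
    z / τ ≠ (k : ℂ) + (l : ℂ) * (-1 / τ) := by
  intro h
  refine hz (-l) k ?_
  rw [div_eq_iff h0] at h
  rw [h]
  push_cast
  field_simp
  ring

lemma notMem_lattice_add_one {τ z : ℂ} (hz : ∀ k l : ℤ, z ≠ (k : ℂ) + (l : ℂ) * τ) (k l : ℤ) :
    z ≠ (k : ℂ) + (l : ℂ) * (τ + 1) := by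
  intro h
  refine hz (k + l) l ?_
  rw [h]
  push_cast
  ring

lemma add_notMem_lattice {τ z : ℂ} (hz : ∀ k l : ℤ, z ≠ (k : ℂ) + (l : ℂ) * τ) (a b k l : ℤ) :
    z + (a + b * τ) ≠ (k : ℂ) + (l : ℂ) * τ := by
  intro h
  refine hz (k - a) (l - b) ?_
  rw [eq_sub_of_add_eq h]
  push_cast
  ring

end MockTheta

theorem theorem1p12 (m s : ℕ) (hs : s ≤ m) :
    -- absolute convergence of all the series involved
    (∀ τ : ℂ, 0 < τ.im →
      (∀ z₁ z₂ : ℂ, (∀ k l : ℤ, z₁ ≠ (k : ℂ) + (l : ℂ) * τ) →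
        Summable (MockTheta.Phi1Term m s τ z₁ z₂)) ∧
      (∀ (j : ℤ) (z : ℂ), Summable (MockTheta.thetaTerm j (m + 1) τ z)) ∧
      (∀ (j : ℤ) (v : ℂ),
        Summable (fun n : {n : ℤ // n ≡ -j [ZMOD 2 * ((m + 1 : ℕ) : ℤ)]} =>
          MockTheta.RTerm j (m + 1) τ v n.1))) ∧
    -- the transformation properties, away from the poles
    (∀ τ z₁ z₂ t : ℂ, 0 < τ.im →
      (∀ k l : ℤ, z₁ ≠ (k : ℂ) + (l : ℂ) * τ) →
      (∀ k l : ℤ, z₂ ≠ (k : ℂ) + (l : ℂ) * τ) →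
      MockTheta.slashS (MockTheta.PhiTilde m s) τ z₁ z₂ t
          = MockTheta.PhiTilde m s τ z₁ z₂ t ∧
      MockTheta.PhiTilde m s (-1 / τ) (z₁ / τ) (z₂ / τ) t
          = τ * MockTheta.e (((m : ℂ) + 1) * z₁ * z₂ / τ)
            * MockTheta.PhiTilde m s τ z₁ z₂ t ∧
      MockTheta.PhiTilde m s (τ + 1) z₁ z₂ t = MockTheta.PhiTilde m s τ z₁ z₂ t ∧
      (∀ a b : ℤ, MockTheta.PhiTilde m s τ (z₁ + (a : ℂ)) (z₂ + (b : ℂ)) t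
          = MockTheta.PhiTilde m s τ z₁ z₂ t) ∧
      (∀ a b : ℤ, MockTheta.PhiTilde m s τ (z₁ + (a : ℂ) * τ) (z₂ + (b : ℂ) * τ) t
          = MockTheta.e (-(((m : ℂ) + 1) * (a : ℂ) * (b : ℂ) * τ))
            * MockTheta.e (-(((m : ℂ) + 1) * ((b : ℂ) * z₁ + (a : ℂ) * z₂)))
            * MockTheta.PhiTilde m s τ z₁ z₂ t)) := by
  refine ⟨fun τ hτ => ⟨fun z₁ z₂ hz₁ => (MockTheta.Phi1_add_correction m s z₂ hτ hz₁).1,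
    fun j z => MockTheta.summable_thetaTerm m.succ_pos hτ j z,
    fun j v => (MockTheta.summable_RTerm j m.succ_pos hτ v).comp_injective
      Subtype.val_injective⟩, ?_⟩
  intro τ z₁ z₂ t hτ hz₁ hz₂
  have h0 : τ ≠ 0 := by
    rintro rfl
    simp at hτ
  have hS : ∀ t : ℂ, MockTheta.PhiTilde m s (-1 / τ) (z₁ / τ) (z₂ / τ) t
      = τ * MockTheta.e (((m : ℂ) + 1) * z₁ * z₂ / τ) * MockTheta.PhiTilde m s τ z₁ z₂ t := by
    intro t
    rw [MockTheta.PhiTilde_eq_latticeSum m s t (MockTheta.im_neg_one_div_pos hτ)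
      (MockTheta.div_notMem_lattice h0 hz₁) (MockTheta.div_notMem_lattice h0 hz₂),
      MockTheta.PhiTilde_eq_latticeSum m s t hτ hz₁ hz₂, ← neg_div, ← neg_div,
      MockTheta.latticeSum_S hτ, MockTheta.latticeSum_S hτ,
      show ((m + 1 : ℕ) : ℂ) * -z₂ * -z₁ / τ = ((m : ℂ) + 1) * z₁ * z₂ / τ by push_cast; ring,
      show ((m + 1 : ℕ) : ℂ) * z₁ * z₂ / τ = ((m : ℂ) + 1) * z₁ * z₂ / τ by push_cast; ring]
    ring
  refine ⟨?_, hS t, ?_, fun a b => ?_, fun a b => ?_⟩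
  -- The shift of `t` in the slash action cancels the index factor.
  · have hshift : MockTheta.PhiTilde m s τ z₁ z₂ (t - z₁ * z₂ / τ)
        = MockTheta.e (-(((m : ℂ) + 1) * z₁ * z₂ / τ)) * MockTheta.PhiTilde m s τ z₁ z₂ t := by
      rw [MockTheta.PhiTilde_eq_latticeSum m s _ hτ hz₁ hz₂,
        MockTheta.PhiTilde_eq_latticeSum m s t hτ hz₁ hz₂, ← mul_assoc, ← MockTheta.e_add]
      congr 2
      ring
    have he := MockTheta.e_ne_zero (((m : ℂ) + 1) * z₁ * z₂ / τ)
    rw [MockTheta.slashS, hS, hshift, MockTheta.e_neg]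
    field_simp
  · have hτ' : 0 < (τ + 1).im := by simpa using hτ
    rw [MockTheta.PhiTilde_eq_latticeSum m s t hτ' (MockTheta.notMem_lattice_add_one hz₁)
      (MockTheta.notMem_lattice_add_one hz₂), MockTheta.PhiTilde_eq_latticeSum m s t hτ hz₁ hz₂,
      MockTheta.latticeSum_T, MockTheta.latticeSum_T]
  · have h1 := MockTheta.add_notMem_lattice hz₁ a 0
    have h2 := MockTheta.add_notMem_lattice hz₂ b 0
    simp only [Int.cast_zero, zero_mul, add_zero] at h1 h2
    rw [MockTheta.PhiTilde_eq_latticeSum m s t hτ h1 h2,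
      MockTheta.PhiTilde_eq_latticeSum m s t hτ hz₁ hz₂,
      show -(z₁ + (a : ℂ)) = -z₁ + ((-a : ℤ) : ℂ) by push_cast; ring,
      show -(z₂ + (b : ℂ)) = -z₂ + ((-b : ℤ) : ℂ) by push_cast; ring]
    simp only [MockTheta.latticeSum_add_int_left, MockTheta.latticeSum_add_int_right]
  · have h1 := MockTheta.add_notMem_lattice hz₁ 0 a
    have h2 := MockTheta.add_notMem_lattice hz₂ 0 b
    simp only [Int.cast_zero, zero_add] at h1 h2
    rw [MockTheta.PhiTilde_eq_latticeSum m s t hτ h1 h2,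
      MockTheta.PhiTilde_eq_latticeSum m s t hτ hz₁ hz₂,
      show -(z₁ + (a : ℂ) * τ) = -z₁ + ((-a : ℤ) : ℂ) * τ by push_cast; ring,
      show -(z₂ + (b : ℂ) * τ) = -z₂ + ((-b : ℤ) : ℂ) * τ by push_cast; ring,
      MockTheta.latticeSum_add_mul hτ, MockTheta.latticeSum_add_mul hτ,
      show -(((m + 1 : ℕ) : ℂ) * ((-b : ℤ) : ℂ) * ((-a : ℤ) : ℂ) * τ)
        = -(((m : ℂ) + 1) * a * b * τ) by push_cast; ring,
      show -(((m + 1 : ℕ) : ℂ) * (((-a : ℤ) : ℂ) * -z₂ + ((-b : ℤ) : ℂ) * -z₁))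
        = -(((m : ℂ) + 1) * (b * z₁ + a * z₂)) by push_cast; ring,
      Nat.cast_succ]
    ring
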